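/- Let $A$ be an Artin algebra, i.e. an algebra over a commutative artinian ring $R$ which is finitely generated as an $R$-module. Modules are taken on one fixed side (in the formal statement, left modules; right $A$-modules are left modules over the Artin algebra $A^{\mathrm{op}}$), $\operatorname{mod} A$ is the category of finitely generated $A$-modules, and $\operatorname{pd}$ is the projective dimension, with values in $\mathbb N\cup\{\infty\}$ and $\operatorname{pd} 0=0$. For $M\in\operatorname{mod}A$ let $\Omega(M)$ be the kernel of a projective cover $P(M)\to M$, with $\Omega^0(M)=M$ and $\Omega^{n+1}(M)=\Omega(\Omega^{n}(M))$. Let $K_0(A)$ be the abelian group generated by the symbols $[M]$, $M\in\operatorname{mod}A$, modulo the relations $[M]-[M']-[M'']$ whenever $M\cong M'\oplus M''$, and $[P]$ for every projective $P$. Let $\bar\Omega:K_0(A)\to K_0(A)$ be the group endomorphism with $\bar\Omega([M])=[\Omega(M)]$, and let $\langle\operatorname{add}M\rangle\subseteq K_0(A)$ be the subgroup generated by the classes of the indecomposable direct summands of $M$. The Igusa–Todorov functions are $$\phi(M)=\min\{\,l\in\mathbb N : \bar\Omega|_{\bar\Omega^{\,l+s}(\langle\operatorname{add}M\rangle)}\text{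 is injective for all } s\ge 0\,\},$$ $$\psi(M)=\phi(M)+\sup\{\operatorname{pd}N : N \text{ is a direct summand of } \Omega^{\phi(M)}(M),\ \operatorname{pd}N<\infty\}.$$ **Theorem (Igusa–Todorov).** Let $0\to M'\to M\to M''\to 0$ be a short exact sequence of finitely generated $A$-modules with $\operatorname{pd}M''<\infty$. Then $\psi(M'\oplus M)$ is finite and $$\operatorname{pd} M''\le \psi(M'\oplus M)+1 .$$ -/

import Mathlib

/-! Igusa-Todorov functions of finitely generated modules over a (left) artinian ring `A`.
`FGModuleCat.{u} A` is the category `mod A`. Modules are left modules; right modules over a ring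
are the left modules over its opposite. -/

universe u w

namespace IgusaTodorov

open CategoryTheory CategoryTheory.Limits


noncomputable section

section ProjectiveCovers

variable {A : Type u} [Ring A]

/-- `π : P → M` is a projective cover: `P` is projective, `π` is onto, and `ker π` is superfluous
in `P`. -/
structure IsProjectiveCover {P M : Type u} [AddCommGroup P] [Module A P] [AddCommGroup M]
    [Module A M] (π : P →ₗ[A] M) : Prop where
  projective : Module.Projective A P
  surjective : Function.Surjective π
  superfluous : ∀ L : Submodule A P, L ⊔ LinearMap.ker π = ⊤ → L = ⊤

/-- Over an artinian ring every finitely generated module has a projective cover. -/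
theorem exists_isProjectiveCover [IsArtinianRing A] (M : FGModuleCat.{u} A) :
    ∃ (P : FGModuleCat.{u} A) (π : P →ₗ[A] M), IsProjectiveCover π := by
  obtain ⟨n, p, hp⟩ := Module.Finite.exists_fin' A M
  -- a minimal submodule `N` of `A ^ n` that still maps onto `M`
  let S : Set (Submodule A (Fin n → A)) := {N | N.map p = ⊤}
  have hS : S.Nonempty := ⟨⊤, by simpa [S, LinearMap.range_eq_top] using hp⟩
  obtain ⟨N, hN, hmin⟩ := IsArtinian.set_has_minimal S hS
  have hmin' : ∀ N' ∈ S, N' ≤ N → N' = N := fun N' h' hle => by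
    by_contra hne
    exact hmin N' h' (lt_of_le_of_ne hle hne)
  let q : N →ₗ[A] M := p ∘ₗ N.subtype
  have hq : Function.Surjective q := by
    rw [← LinearMap.range_eq_top, LinearMap.range_comp, Submodule.range_subtype]
    exact hN
  obtain ⟨h, hh⟩ := Module.projective_lifting_property q p hq
  -- any endomorphism of `N` over `M` is onto
  let e : N →ₗ[A] N := h ∘ₗ N.subtype
  have hqe : q ∘ₗ e = q := by
    rw [← LinearMap.comp_assoc, hh]
  have he : Function.Surjective e := by
    have h1 : (LinearMap.range e).map N.subtype ∈ S := by
      change ((LinearMap.range e).map N.subtype).map p = ⊤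
      rw [← Submodule.map_comp, ← LinearMap.range_comp]
      change LinearMap.range (q ∘ₗ e) = ⊤
      rw [hqe, LinearMap.range_eq_top]
      exact hq
    have h2 := hmin' _ h1 (Submodule.map_subtype_le _ _)
    rw [← LinearMap.range_eq_top]
    apply Submodule.map_injective_of_injective N.injective_subtype
    rw [h2, Submodule.map_top, Submodule.range_subtype]
  have hei : Function.Injective e := IsNoetherian.injective_of_surjective_endomorphism e he
  let E : N ≃ₗ[A] N := LinearEquiv.ofBijective e ⟨hei, he⟩
  have hproj : Module.Projective A N := by
    refine Module.Projective.of_split N.subtype (E.symm.toLinearMap ∘ₗ h) ?_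
    ext x
    change ((E.symm (e x) : N) : Fin n → A) _ = _
    rw [show e x = E x from rfl, E.symm_apply_apply]
    rfl
  refine ⟨FGModuleCat.of A N, q, hproj, hq, fun L hL => ?_⟩
  have h1 : L.map N.subtype ∈ S := by
    change (L.map N.subtype).map p = ⊤
    rw [← Submodule.map_comp]
    have := congrArg (Submodule.map q) hL
    rw [Submodule.map_sup, Submodule.map_top, LinearMap.range_eq_top.mpr hq,
      (LinearMap.le_ker_iff_map).mp le_rfl, sup_bot_eq] at this
    exact this
  have h2 := hmin' _ h1 (Submodule.map_subtype_le _ _)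
  apply Submodule.map_injective_of_injective N.injective_subtype
  rw [h2, Submodule.map_top, Submodule.range_subtype]

/-- Schanuel's lemma. -/
theorem schanuel {P Q M : Type u} [AddCommGroup P] [Module A P] [AddCommGroup Q] [Module A Q]
    [AddCommGroup M] [Module A M] [Module.Projective A P] [Module.Projective A Q]
    (π : P →ₗ[A] M) (ρ : Q →ₗ[A] M) (hπ : Function.Surjective π) (hρ : Function.Surjective ρ) :
    Nonempty ((LinearMap.ker π × Q) ≃ₗ[A] (LinearMap.ker ρ × P)) := by
  obtain ⟨s, hs⟩ := Module.projective_lifting_property ρ π hρ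
  obtain ⟨t, ht⟩ := Module.projective_lifting_property π ρ hπ
  have hs' : ∀ x, ρ (s x) = π x := fun x => LinearMap.congr_fun hs x
  have ht' : ∀ x, π (t x) = ρ x := fun x => LinearMap.congr_fun ht x
  refine ⟨{
    toFun := fun x => (⟨x.2 - s (x.1 + t x.2), by
      have := x.1.2
      simp only [LinearMap.mem_ker] at this ⊢
      simp [hs', ht', this]⟩, x.1 + t x.2)
    invFun := fun y => (⟨y.2 - t (y.1 + s y.2), by
      have := y.1.2
      simp only [LinearMap.mem_ker] at this ⊢
      simp [hs', ht', this]⟩, y.1 + s y.2)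
    map_add' := fun x y => by
      ext
      · simp only [Prod.fst_add, Prod.snd_add, Submodule.coe_add, map_add]; abel
      · simp only [Prod.fst_add, Prod.snd_add, Submodule.coe_add, map_add]; abel
    map_smul' := fun r x => by
      ext
      · simp [smul_sub, smul_add]
      · simp [smul_add]
    left_inv := fun x => by ext <;> simp
    right_inv := fun x => by ext <;> simp }⟩

/-- The product of two submodules, as a submodule of the product and as a product of modules. -/
def prodSubmoduleEquiv {P Q : Type u} [AddCommGroup P] [Module A P] [AddCommGroup Q] [Module A Q]
    (K : Submodule A P) (L : Submodule A Q) : (K.prod L) ≃ₗ[A] (K × L) where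
  toFun x := (⟨x.1.1, x.2.1⟩, ⟨x.1.2, x.2.2⟩)
  invFun y := ⟨(y.1.1, y.2.1), y.1.2, y.2.2⟩
  map_add' _ _ := rfl
  map_smul' _ _ := rfl
  left_inv _ := rfl
  right_inv _ := rfl

end ProjectiveCovers

section Syzygy

variable {A : Type u} [Ring A] [IsArtinianRing A]

/-- The projective cover `P(M)` of `M`. -/
def projectiveCover (M : FGModuleCat.{u} A) : FGModuleCat.{u} A :=
  (exists_isProjectiveCover M).choose

/-- The map `P(M) → M`. -/
def projectiveCoverMap (M : FGModuleCat.{u} A) : projectiveCover M →ₗ[A] M :=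
  (exists_isProjectiveCover M).choose_spec.choose

theorem isProjectiveCover_projectiveCoverMap (M : FGModuleCat.{u} A) :
    IsProjectiveCover (projectiveCoverMap M) :=
  (exists_isProjectiveCover M).choose_spec.choose_spec

/-- The syzygy `Ω(M)`, the kernel of the projective cover `P(M) → M`. -/
def syzygy (M : FGModuleCat.{u} A) : FGModuleCat.{u} A :=
  FGModuleCat.of A (LinearMap.ker (projectiveCoverMap M))

/-- The iterated syzygy `Ωⁿ(M)`, with `Ω⁰(M) = M`. -/
def iteratedSyzygy (n : ℕ) (M : FGModuleCat.{u} A) : FGModuleCat.{u} A :=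
  syzygy^[n] M

end Syzygy

section GrothendieckGroup

variable (A : Type u) [Ring A]

/-- The relations `[M] - [M'] - [M'']` for `M ≅ M' ⊕ M''`, and `[P]` for `P` projective. -/
inductive Relator : FreeAbelianGroup (FGModuleCat.{u} A) → Prop
  | sum (M M' M'' : FGModuleCat.{u} A) (e : M ≃ₗ[A] (M' × M'')) :
      Relator (FreeAbelianGroup.of M - FreeAbelianGroup.of M' - FreeAbelianGroup.of M'')
  | projective (P : FGModuleCat.{u} A) (hP : Module.Projective A P) :
      Relator (FreeAbelianGroup.of P)

/-- The abelian group `K₀(A)` generated by the symbols `[M]`, `M ∈ mod A`, subject to the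
relations above. -/
abbrev K₀ : Type (u + 1) :=
  FreeAbelianGroup (FGModuleCat.{u} A) ⧸ AddSubgroup.closure {x | Relator A x}

variable {A}

/-- The class `[M]` in `K₀(A)`. -/
def K₀.mk (M : FGModuleCat.{u} A) : K₀ A :=
  QuotientAddGroup.mk (FreeAbelianGroup.of M)

theorem K₀.mk_sum {M M' M'' : FGModuleCat.{u} A} (e : M ≃ₗ[A] (M' × M'')) :
    K₀.mk M = K₀.mk M' + K₀.mk M'' := by
  have h : (QuotientAddGroup.mk (FreeAbelianGroup.of M - FreeAbelianGroup.of M' -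
      FreeAbelianGroup.of M'') : K₀ A) = 0 :=
    (QuotientAddGroup.eq_zero_iff _).mpr
      (AddSubgroup.subset_closure (Relator.sum M M' M'' e))
  have h' : K₀.mk M - K₀.mk M' - K₀.mk M'' = 0 := h
  rw [sub_sub, sub_eq_zero] at h'
  exact h'

theorem K₀.mk_projective {P : FGModuleCat.{u} A} (hP : Module.Projective A P) :
    K₀.mk P = 0 :=
  (QuotientAddGroup.eq_zero_iff _).mpr (AddSubgroup.subset_closure (Relator.projective P hP))

theorem K₀.mk_congr {M N : FGModuleCat.{u} A} (e : M ≃ₗ[A] N) : K₀.mk M = K₀.mk N := by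
  have h0 : K₀.mk (FGModuleCat.of A PUnit.{u + 1}) = 0 :=
    K₀.mk_projective (P := FGModuleCat.of A PUnit.{u + 1})
      (inferInstanceAs (Module.Projective A PUnit.{u + 1}))
  have e' : M ≃ₗ[A] (N × FGModuleCat.of A PUnit.{u + 1}) :=
    e.trans (LinearEquiv.prodUnique (R := A) (M := N) (M₂ := PUnit.{u + 1})).symm
  rw [K₀.mk_sum e', h0, add_zero]

variable [IsArtinianRing A]

/-- In `K₀(A)`, the class of `Ω(M)` is that of the kernel of any map onto `M` from a finitely
generated projective module. -/
theorem K₀.mk_ker (M P : FGModuleCat.{u} A) (hP : Module.Projective A P) (π : P →ₗ[A] M)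
    (hπ : Function.Surjective π) :
    K₀.mk (FGModuleCat.of A (LinearMap.ker π)) = K₀.mk (syzygy M) := by
  have hc := isProjectiveCover_projectiveCoverMap M
  have hQ : Module.Projective A (projectiveCover M) := hc.projective
  obtain ⟨e⟩ := schanuel π (projectiveCoverMap M) hπ hc.surjective
  let X : FGModuleCat.{u} A := FGModuleCat.of A (LinearMap.ker π × projectiveCover M)
  have h1 : K₀.mk X = K₀.mk (FGModuleCat.of A (LinearMap.ker π)) + K₀.mk (projectiveCover M) :=
    K₀.mk_sum (LinearEquiv.refl A (LinearMap.ker π × projectiveCover M))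
  have h2 : K₀.mk X = K₀.mk (syzygy M) + K₀.mk P :=
    K₀.mk_sum (M := X) (M' := syzygy M) (M'' := P) e
  rw [K₀.mk_projective hQ, add_zero] at h1
  rw [K₀.mk_projective hP, add_zero] at h2
  rw [← h1, h2]

/-- The endomorphism `Ω̄` of `K₀(A)` induced by `Ω`, that is, `Ω̄[M] = [Ω(M)]`. -/
def syzygyHom : K₀ A →+ K₀ A :=
  QuotientAddGroup.lift _ (FreeAbelianGroup.lift fun M => K₀.mk (syzygy M)) <| by
    rw [AddSubgroup.closure_le]
    rintro _ (⟨M, M', M'', e⟩ | ⟨P, hP⟩)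
    · change FreeAbelianGroup.lift _ _ = 0
      rw [map_sub, map_sub, FreeAbelianGroup.lift_apply_of, FreeAbelianGroup.lift_apply_of,
        FreeAbelianGroup.lift_apply_of, sub_sub, sub_eq_zero]
      have h' := isProjectiveCover_projectiveCoverMap M'
      have h'' := isProjectiveCover_projectiveCoverMap M''
      have := h'.projective
      have := h''.projective
      let p := projectiveCoverMap M'
      let q := projectiveCoverMap M''
      let r : (projectiveCover M' × projectiveCover M'') →ₗ[A] M :=
        e.symm.toLinearMap ∘ₗ p.prodMap q
      have hr : Function.Surjective r :=
        e.symm.surjective.comp (h'.surjective.prodMap h''.surjective)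
      have hker : LinearMap.ker r = (LinearMap.ker p).prod (LinearMap.ker q) := by
        rw [LinearEquiv.ker_comp, LinearMap.ker_prodMap]
      rw [← K₀.mk_ker M (FGModuleCat.of A (projectiveCover M' × projectiveCover M''))
        (inferInstanceAs (Module.Projective A (projectiveCover M' × projectiveCover M''))) r hr]
      exact K₀.mk_sum (M' := syzygy M') (M'' := syzygy M'')
        ((LinearEquiv.ofEq _ _ hker).trans (prodSubmoduleEquiv _ _))
    · change FreeAbelianGroup.lift _ _ = 0
      rw [FreeAbelianGroup.lift_apply_of,
        ← K₀.mk_ker P P hP LinearMap.id Function.surjective_id]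
      have : Subsingleton (LinearMap.ker (LinearMap.id : P →ₗ[A] P)) := by
        rw [LinearMap.ker_id]; infer_instance
      exact K₀.mk_projective
        (inferInstanceAs (Module.Projective A (LinearMap.ker (LinearMap.id : P →ₗ[A] P))))

theorem syzygyHom_mk (M : FGModuleCat.{u} A) : syzygyHom (K₀.mk M) = K₀.mk (syzygy M) :=
  FreeAbelianGroup.lift_apply_of _ _

end GrothendieckGroup

section Functions

variable {A : Type u} [Ring A]

/-- The projective dimension `pd M ∈ ℕ ∪ {∞}`, with the convention `pd 0 = 0`
(the underlying notion of Mathlib takes the value `⊥` at the zero module). -/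
def pd (M : FGModuleCat.{u} A) : ℕ∞ :=
  (projectiveDimension M.obj).unbotD 0

/-- `N` is isomorphic to a direct summand of `M`. -/
def IsSummand (N M : FGModuleCat.{u} A) : Prop :=
  ∃ N' : FGModuleCat.{u} A, Nonempty (M ≃ₗ[A] (N × N'))

/-- The subgroup `⟨add M⟩` of `K₀(A)` generated by the classes of the indecomposable direct
summands of `M`. -/
def addSubgroup (M : FGModuleCat.{u} A) : AddSubgroup (K₀ A) :=
  AddSubgroup.closure {x | ∃ N : FGModuleCat.{u} A, Indecomposable N.obj ∧ IsSummand N M ∧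
    x = K₀.mk N}

variable [IsArtinianRing A]

/-- The first Igusa-Todorov function: the least `l` such that `Ω̄` is injective on
`Ω̄ˡ⁺ˢ(⟨add M⟩)` for all `s ≥ 0`. -/
def phi (M : FGModuleCat.{u} A) : ℕ :=
  sInf {l : ℕ | ∀ s : ℕ,
    Set.InjOn (syzygyHom (A := A)) ((syzygyHom (A := A))^[l + s] '' (addSubgroup M : Set (K₀ A)))}

/-- The second Igusa-Todorov function: `φ(M)` plus the supremum of the finite projective
dimensions of direct summands of `Ω^φ(M)(M)`. -/
def psi (M : FGModuleCat.{u} A) : ℕ∞ :=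
  (phi M : ℕ∞) +
    ⨆ (N : FGModuleCat.{u} A) (_ : IsSummand N (iteratedSyzygy (phi M) M)) (_ : pd N ≠ ⊤), pd N

end Functions

end

end IgusaTodorov

/-!
Let `0 → M' → M → M'' → 0` be exact with `pd M'' = n` finite, and put `r = φ(M' ⊕ M)`. If `n ≤ r`
there is nothing to prove. Otherwise the horseshoe lemma (`exists_exact_iterate`) provides, for each
`k`, an exact sequence `0 → K' → K → K'' → 0` where `K'` and `K` represent `Ω̄ᵏ[M']` and `Ω̄ᵏ[M]`
in `K₀(A)` and `pd K'' = n - k` for `k ≤ n`. For `k = n` the module `K''` is projective, the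
sequence splits, and `Ω̄ⁿ([M'] - [M]) = 0`. Since `[M'] - [M]` lies in `⟨add (M' ⊕ M)⟩`, the definition of
`φ` gives `Ω̄ʳ([M'] - [M]) = 0` (`iterate_phi_eq_zero`), so that `[K'] = [K]` for `k = r`.

Finitely generated modules over an artinian ring satisfy the Krull–Schmidt theorem: an
indecomposable module has a local endomorphism ring, hence is prime with respect to direct sums
(`IsSummand.of_prod_of_isLocalRing`) and can be cancelled (`nonempty_linearEquiv_of_prod`). By
cancellation, modules with the same class in `K₀(A)` are isomorphic up to projective summands
(`stablyIsomorphic_of_mk_eq`). For `k = r` the exact sequence therefore takes the form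
`0 → X → X ⊕ P → D → 0` with `X = K' ⊕ P`, with `P` projective and with `D` the sum of `K''` and a
projective module. The Fitting decomposition of its entry `X → X` has a nilpotent part `Z`, a
summand of `X`, with `pd Z < ∞` and `pd D ≤ pd Z + 1` (`exists_isSummand_pd_le_pd_add_one`). By primeness
the nonprojective indecomposable summands of `Z` are summands of `Ωʳ(M' ⊕ M)`
(`pd_le_iSup_of_mk_add_eq`), and the inequality follows.

The Krull–Schmidt theorem also accounts for finiteness. A module has only finitely many
indecomposable summands up to isomorphism (`exists_finite_isSummand`). Hence `⟨add M⟩` is a finitely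
generated abelian group, on which the kernels of the powers of `Ω̄` stabilise, so that the minimum
defining `φ` is attained (`injOn_syzygyHom_phi`), and the supremum defining `ψ` is finite
(`iSup_pd_summand_ne_top`).
-/

namespace IgusaTodorov

open CategoryTheory CategoryTheory.Limits

noncomputable section

/-! ### Modules with local endomorphism ring -/

section LocalEnd

variable {A : Type u} [Ring A]

/-- By Fitting's lemma every endomorphism of an indecomposable module of finite length is invertible
or nilpotent, so that the endomorphism ring is local. -/
theorem isLocalRing_end_of_isCompl {M : Type u} [AddCommGroup M] [Module A M] [IsArtinian A M]
    [IsNoetherian A M] [Nontrivial M]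
    (h : ∀ K L : Submodule A M, IsCompl K L → K = ⊥ ∨ L = ⊥) :
    IsLocalRing (Module.End A M) := by
  refine IsLocalRing.of_isUnit_or_isUnit_one_sub_self fun f => ?_
  obtain ⟨n, hn, hpos⟩ := (f.eventually_isCompl_ker_pow_range_pow.and
    (Filter.eventually_ge_atTop 1)).exists
  rcases h _ _ hn with h0 | h0
  · left
    have h1 : LinearMap.range (f ^ n) = ⊤ := by
      have := hn.sup_eq_top
      rwa [h0, bot_sup_eq] at this
    have : IsUnit (f ^ n) :=
      (Module.End.isUnit_iff _).mpr ⟨LinearMap.ker_eq_bot.mp h0, LinearMap.range_eq_top.mp h1⟩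
    exact (isUnit_pow_iff (by omega)).mp this
  · right
    exact IsNilpotent.isUnit_one_sub ⟨n, LinearMap.range_eq_bot.mp h0⟩

/-- A split monomorphism `i` with retraction `p` identifies the target with `N × ker p`. -/
def prodKerEquivOfRetract {N X : Type u} [AddCommGroup N] [Module A N] [AddCommGroup X]
    [Module A X] (i : N →ₗ[A] X) (p : X →ₗ[A] N) (h : p ∘ₗ i = LinearMap.id) :
    X ≃ₗ[A] (N × LinearMap.ker p) where
  toFun x := (p x, ⟨x - i (p x), by
    have := LinearMap.congr_fun h (p x)
    simp only [LinearMap.comp_apply, LinearMap.id_apply] at this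
    simp [this]⟩)
  invFun y := i y.1 + y.2
  map_add' x y := by
    ext
    · simp
    · simp only [map_add, Prod.snd_add, Submodule.coe_add]; abel
  map_smul' r x := by
    ext
    · simp
    · simp [smul_sub]
  left_inv x := by simp
  right_inv y := by
    have h1 := LinearMap.congr_fun h y.1
    have h2 : p y.2 = 0 := y.2.2
    simp only [LinearMap.comp_apply, LinearMap.id_apply] at h1
    ext <;> simp [h1, h2]

/-- Cancellation of a module with local endomorphism ring. -/
theorem nonempty_linearEquiv_of_prod_of_isLocalRing {N X Y : Type u} [AddCommGroup N] [Module A N]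
    [AddCommGroup X] [Module A X] [AddCommGroup Y] [Module A Y]
    [IsLocalRing (Module.End A N)] (e : (N × X) ≃ₗ[A] (N × Y)) : Nonempty (X ≃ₗ[A] Y) := by
  -- an isomorphism whose `N → N` entry is invertible can be reduced to a diagonal one
  have key : ∀ e : (N × X) ≃ₗ[A] (N × Y),
      IsUnit ((LinearMap.fst A N Y ∘ₗ e.toLinearMap ∘ₗ LinearMap.inl A N X : Module.End A N)) →
      Nonempty (X ≃ₗ[A] Y) := by
    intro e hu
    obtain ⟨u, hu⟩ := hu
    have hu1 : ∀ x, (e (x, 0)).1 = u.1 x := fun x => (LinearMap.congr_fun hu x).symm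
    have hl : ∀ x, u⁻¹.1 (u.1 x) = x := fun x => LinearMap.congr_fun u.inv_mul x
    have hr : ∀ x, u.1 (u⁻¹.1 x) = x := fun x => LinearMap.congr_fun u.mul_inv x
    have hs : ∀ (a : N) (x : X), e (a, x) = e (a, 0) + e (0, x) := fun a x => by
      rw [← map_add]; simp
    let S : X →ₗ[A] Y := LinearMap.snd A N Y ∘ₗ e.toLinearMap ∘ₗ
      (LinearMap.inr A N X - LinearMap.inl A N X ∘ₗ u⁻¹.1 ∘ₗ LinearMap.fst A N Y ∘ₗ
        e.toLinearMap ∘ₗ LinearMap.inr A N X)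
    have hS : ∀ x, S x = (e (-(u⁻¹.1 (e (0, x)).1), x)).2 := fun x => by
      simp [S]
    have h0 : ∀ x, (e (-(u⁻¹.1 (e (0, x)).1), x)).1 = 0 := fun x => by
      rw [hs, Prod.fst_add, hu1, map_neg, hr]; simp
    refine ⟨LinearEquiv.ofBijective S ⟨?_, ?_⟩⟩
    · rw [injective_iff_map_eq_zero]
      intro x hx
      rw [hS] at hx
      have : e (-(u⁻¹.1 (e (0, x)).1), x) = 0 := Prod.ext (h0 x) hx
      rw [LinearEquiv.map_eq_zero_iff] at this
      exact congrArg Prod.snd this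
    · intro y
      obtain ⟨⟨a, x⟩, hax⟩ := e.surjective (0, y)
      refine ⟨x, ?_⟩
      have h1 : u.1 a + (e (0, x)).1 = 0 := by
        have := congrArg Prod.fst hax
        rwa [hs, Prod.fst_add, hu1] at this
      have h2 : a = -(u⁻¹.1 (e (0, x)).1) := by
        rw [← hl a, eq_neg_of_add_eq_zero_left h1, map_neg]
      rw [hS, ← h2, hax]
  let a : Module.End A N := LinearMap.fst A N Y ∘ₗ e.toLinearMap ∘ₗ LinearMap.inl A N X
  let c : N →ₗ[A] Y := LinearMap.snd A N Y ∘ₗ e.toLinearMap ∘ₗ LinearMap.inl A N X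
  let a' : Module.End A N := LinearMap.fst A N X ∘ₗ e.symm.toLinearMap ∘ₗ LinearMap.inl A N Y
  let b' : Y →ₗ[A] N := LinearMap.fst A N X ∘ₗ e.symm.toLinearMap ∘ₗ LinearMap.inr A N Y
  by_cases ha : IsUnit a
  · exact key e ha
  have hsum : a' * a + b' ∘ₗ c = 1 := by
    ext x
    change (e.symm ((e (x, 0)).1, 0)).1 + (e.symm (0, (e (x, 0)).2)).1 = x
    rw [← Prod.fst_add, ← map_add]
    simp
  have hbc : IsUnit (b' ∘ₗ c : Module.End A N) := by
    rcases IsLocalRing.isUnit_or_isUnit_of_add_one hsum with h | h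
    · -- otherwise `a` has a left inverse, which in a local ring makes it invertible
      exfalso
      obtain ⟨v, hv⟩ := h
      have hleft : (v⁻¹.1 * a') * a = 1 := by rw [mul_assoc, ← hv]; exact v.inv_mul
      have hid : IsIdempotentElem (a * (v⁻¹.1 * a')) := by
        rw [IsIdempotentElem, mul_assoc, ← mul_assoc (v⁻¹.1 * a'), hleft, one_mul]
      rcases IsLocalRing.isUnit_or_isUnit_of_add_one
        (add_sub_cancel (a * (v⁻¹.1 * a')) 1) with h | h
      · have h1 := (IsIdempotentElem.iff_eq_one_of_isUnit h).mp hid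
        exact ha ⟨⟨a, v⁻¹.1 * a', h1, hleft⟩, rfl⟩
      · have h1 := (IsIdempotentElem.iff_eq_one_of_isUnit h).mp hid.one_sub
        have h2 : a * (v⁻¹.1 * a') = 0 := by simpa using h1
        have h3 : a = 0 := by
          have : a * ((v⁻¹.1 * a') * a) = 0 := by rw [← mul_assoc, h2, zero_mul]
          rwa [hleft, mul_one] at this
        rw [h3, mul_zero] at hleft
        exact zero_ne_one hleft
    · exact h
  obtain ⟨v, hv⟩ := hbc
  -- adding a multiple of the second row to the first turns the entry `a` into `a + 1`
  let t : Y →ₗ[A] N := v⁻¹.1 ∘ₗ b'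
  have ht : ∀ x, t (c x) = x := fun x => by
    change v⁻¹.1 ((b' ∘ₗ c) x) = x
    rw [← hv]
    exact LinearMap.congr_fun v.inv_mul x
  let T : (N × Y) ≃ₗ[A] (N × Y) :=
    { toFun := fun z => (z.1 + t z.2, z.2)
      invFun := fun z => (z.1 - t z.2, z.2)
      map_add' := fun x y => by
        ext
        · simp only [Prod.fst_add, Prod.snd_add, map_add]; abel
        · rfl
      map_smul' := fun r x => by ext <;> simp
      left_inv := fun x => by ext <;> simp
      right_inv := fun x => by ext <;> simp }
  refine key (e.trans T) ?_
  have h1 : (LinearMap.fst A N Y ∘ₗ (e.trans T).toLinearMap ∘ₗ LinearMap.inl A N X :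
      Module.End A N) = a + 1 := by
    ext x
    change a x + t (c x) = a x + x
    rw [ht]
  rw [h1]
  rcases IsLocalRing.isUnit_or_isUnit_of_add_one
    (show (a + 1) + (-a) = 1 by abel) with h | h
  · exact h
  · exact absurd (by simpa using h) ha

end LocalEnd

/-! ### Direct sum decompositions of finitely generated modules -/

section Decomposition

variable {A : Type u} [Ring A]

theorem IsSummand.of_equiv {N M M₁ : FGModuleCat.{u} A} (h : IsSummand N M) (e : M ≃ₗ[A] M₁) :
    IsSummand N M₁ := by
  obtain ⟨N', ⟨e'⟩⟩ := h
  exact ⟨N', ⟨e.symm.trans e'⟩⟩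

theorem IsSummand.trans {N M L : FGModuleCat.{u} A} (h : IsSummand N M) (h' : IsSummand M L) :
    IsSummand N L := by
  obtain ⟨N', ⟨e⟩⟩ := h
  obtain ⟨M', ⟨e'⟩⟩ := h'
  exact ⟨FGModuleCat.of A (N' × M'),
    ⟨e'.trans ((e.prodCongr (LinearEquiv.refl A M')).trans (LinearEquiv.prodAssoc A N N' M'))⟩⟩

theorem isSummand_prod_left (M N : FGModuleCat.{u} A) : IsSummand M (FGModuleCat.of A (M × N)) :=
  ⟨N, ⟨LinearEquiv.refl A (M × N)⟩⟩

theorem isSummand_prod_right (M N : FGModuleCat.{u} A) : IsSummand N (FGModuleCat.of A (M × N)) :=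
  ⟨M, ⟨LinearEquiv.prodComm A M N⟩⟩

theorem isSummand_of_retract [IsArtinianRing A] {N X : FGModuleCat.{u} A} (i : N →ₗ[A] X)
    (p : X →ₗ[A] N) (h : p ∘ₗ i = LinearMap.id) : IsSummand N X :=
  ⟨FGModuleCat.of A (LinearMap.ker p), ⟨prodKerEquivOfRetract i p h⟩⟩

/-- Modules with local endomorphism ring are prime with respect to direct sums. -/
theorem IsSummand.of_prod_of_isLocalRing [IsArtinianRing A] {N X Y Z : FGModuleCat.{u} A}
    [IsLocalRing (Module.End A N)] (h : IsSummand N Z) (e : Z ≃ₗ[A] (X × Y)) :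
    IsSummand N X ∨ IsSummand N Y := by
  obtain ⟨N', ⟨e'⟩⟩ := h
  let E : (N × N') ≃ₗ[A] (X × Y) := e'.symm.trans e
  let i₁ : N →ₗ[A] X := LinearMap.fst A X Y ∘ₗ E.toLinearMap ∘ₗ LinearMap.inl A N N'
  let i₂ : N →ₗ[A] Y := LinearMap.snd A X Y ∘ₗ E.toLinearMap ∘ₗ LinearMap.inl A N N'
  let p₁ : X →ₗ[A] N := LinearMap.fst A N N' ∘ₗ E.symm.toLinearMap ∘ₗ LinearMap.inl A X Y
  let p₂ : Y →ₗ[A] N := LinearMap.fst A N N' ∘ₗ E.symm.toLinearMap ∘ₗ LinearMap.inr A X Y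
  have hsum : (p₁ ∘ₗ i₁ + p₂ ∘ₗ i₂ : Module.End A N) = 1 := by
    ext x
    change (E.symm ((E (x, 0)).1, 0)).1 + (E.symm (0, (E (x, 0)).2)).1 = x
    rw [← Prod.fst_add, ← map_add]
    simp
  rcases IsLocalRing.isUnit_or_isUnit_of_add_one hsum with ⟨v, hv⟩ | ⟨v, hv⟩
  · refine Or.inl (isSummand_of_retract i₁ (v⁻¹.1 ∘ₗ p₁) ?_)
    rw [LinearMap.comp_assoc, ← hv]
    exact v.inv_mul
  · refine Or.inr (isSummand_of_retract i₂ (v⁻¹.1 ∘ₗ p₂) ?_)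
    rw [LinearMap.comp_assoc, ← hv]
    exact v.inv_mul

theorem not_isSummand_of_subsingleton {N X : FGModuleCat.{u} A} [Nontrivial N] [Subsingleton X] :
    ¬ IsSummand N X := by
  rintro ⟨N', ⟨e⟩⟩
  have := e.symm.toEquiv.subsingleton
  obtain ⟨x, y, hxy⟩ := exists_pair_ne N
  exact hxy (congrArg Prod.fst (Subsingleton.elim (x, (0 : N')) (y, 0)))

theorem nontrivial_of_isLocalRing_end {N : Type u} [AddCommGroup N] [Module A N]
    [IsLocalRing (Module.End A N)] : Nontrivial N := by
  by_contra h
  rw [not_nontrivial_iff_subsingleton] at h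
  exact zero_ne_one (α := Module.End A N) (LinearMap.ext fun x => Subsingleton.elim _ _)

/-- A direct sum decomposition with local endomorphism ring has a trivial factor. -/
theorem subsingleton_or_of_isLocalRing_end {M X Y : Type u} [AddCommGroup M] [Module A M]
    [AddCommGroup X] [Module A X] [AddCommGroup Y] [Module A Y]
    [IsLocalRing (Module.End A M)] (e : M ≃ₗ[A] (X × Y)) : Subsingleton X ∨ Subsingleton Y := by
  let a : Module.End A M :=
    e.symm.toLinearMap ∘ₗ LinearMap.inl A X Y ∘ₗ LinearMap.fst A X Y ∘ₗ e.toLinearMap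
  have ha : IsIdempotentElem a := by
    ext x; simp [a]
  rcases IsLocalRing.isUnit_or_isUnit_of_add_one (add_sub_cancel a 1) with h | h
  · right
    have h1 := (IsIdempotentElem.iff_eq_one_of_isUnit h).mp ha
    refine subsingleton_of_forall_eq 0 fun y => ?_
    have h2 := LinearMap.congr_fun h1 (e.symm (0, y))
    have h3 := congrArg e h2
    simpa [a] using h3.symm
  · left
    have h1 := (IsIdempotentElem.iff_eq_one_of_isUnit h).mp ha.one_sub
    have h1' : a = 0 := by simpa using h1
    refine subsingleton_of_forall_eq 0 fun x => ?_
    have h2 := LinearMap.congr_fun h1' (e.symm (x, 0))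
    have h3 := congrArg e h2
    simpa [a] using h3

theorem indecomposable_of_isLocalRing_end (M : FGModuleCat.{u} A)
    [IsLocalRing (Module.End A M)] : Indecomposable M.obj := by
  refine ⟨fun h => ?_, fun Y Z e => ?_⟩
  · have := ModuleCat.isZero_iff_subsingleton.mp h
    exact not_subsingleton_iff_nontrivial.mpr (nontrivial_of_isLocalRing_end (A := A) (N := M)) this
  · rw [ModuleCat.isZero_iff_subsingleton, ModuleCat.isZero_iff_subsingleton]
    exact subsingleton_or_of_isLocalRing_end (M := M)
      (e ≪≫ ModuleCat.biprodIsoProd Y Z).toLinearEquiv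

variable [IsArtinianRing A]

theorem isLocalRing_end_of_indecomposable {M : FGModuleCat.{u} A} (h : Indecomposable M.obj) :
    IsLocalRing (Module.End A M) := by
  have : Nontrivial M := by
    rw [← not_subsingleton_iff_nontrivial]
    exact fun h' => h.1 (ModuleCat.isZero_iff_subsingleton.mpr h')
  refine isLocalRing_end_of_isCompl fun K L hKL => ?_
  have e : M.obj ≅ ModuleCat.of A K ⊞ ModuleCat.of A L :=
    (Submodule.prodEquivOfIsCompl K L hKL).symm.toModuleIso ≪≫
      (ModuleCat.biprodIsoProd (ModuleCat.of A K) (ModuleCat.of A L)).symm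
  rcases h.2 _ _ e with h' | h'
  · exact Or.inl (Submodule.subsingleton_iff_eq_bot.mp (ModuleCat.isZero_iff_subsingleton.mp h'))
  · exact Or.inr (Submodule.subsingleton_iff_eq_bot.mp (ModuleCat.isZero_iff_subsingleton.mp h'))

/-- Induction on the direct sum decompositions of a finitely generated module: it is enough to
treat zero modules, modules with local endomorphism ring, and direct sums. -/
theorem decomposition_induction {p : FGModuleCat.{u} A → Prop}
    (equiv : ∀ (M N : FGModuleCat.{u} A) (_ : M ≃ₗ[A] N), p M → p N)
    (zero : ∀ M : FGModuleCat.{u} A, Subsingleton M → p M)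
    (isLocal : ∀ M : FGModuleCat.{u} A, IsLocalRing (Module.End A M) → p M)
    (prod : ∀ M N : FGModuleCat.{u} A, p M → p N → p (FGModuleCat.of A (M × N)))
    (M : FGModuleCat.{u} A) : p M := by
  induction hn : Module.length A M using WellFoundedLT.induction generalizing M with
  | ind n ih =>
  subst hn
  rcases subsingleton_or_nontrivial M with h | h
  · exact zero M h
  by_cases hM : ∀ K L : Submodule A M, IsCompl K L → K = ⊥ ∨ L = ⊥
  · exact isLocal M (isLocalRing_end_of_isCompl hM)
  push Not at hM
  obtain ⟨K, L, hKL, hK, hL⟩ := hM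
  have hlen : Module.length A M = Module.length A K + Module.length A L := by
    rw [← Module.length_prod, (Submodule.prodEquivOfIsCompl K L hKL).length_eq]
  have hK' : Module.length A K ≠ 0 := by
    rwa [Ne, Module.length_eq_zero_iff, Submodule.subsingleton_iff_eq_bot]
  have hL' : Module.length A L ≠ 0 := by
    rwa [Ne, Module.length_eq_zero_iff, Submodule.subsingleton_iff_eq_bot]
  refine equiv (FGModuleCat.of A (K × L)) M (Submodule.prodEquivOfIsCompl K L hKL)
    (prod (FGModuleCat.of A K) (FGModuleCat.of A L) (ih _ ?_ _ rfl) (ih _ ?_ _ rfl))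
  · rw [hlen]
    exact (ENat.add_lt_add_iff_left (Module.length_ne_top (M := K))).mpr
      (pos_iff_ne_zero.mpr hL') |>.trans_eq' (add_zero _)
  · rw [hlen, add_comm]
    exact (ENat.add_lt_add_iff_left (Module.length_ne_top (M := L))).mpr
      (pos_iff_ne_zero.mpr hK') |>.trans_eq' (add_zero _)

/-- Finitely generated modules over an artinian ring can be cancelled from direct sums. -/
theorem nonempty_linearEquiv_of_prod (N X Y : FGModuleCat.{u} A)
    (e : (N × X) ≃ₗ[A] (N × Y)) : Nonempty (X ≃ₗ[A] Y) := by
  revert X Y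
  refine decomposition_induction (p := fun N => ∀ X Y : FGModuleCat.{u} A,
    ((N × X) ≃ₗ[A] (N × Y)) → Nonempty (X ≃ₗ[A] Y)) ?_ ?_ ?_ ?_ N
  · intro M N f h X Y e
    exact h X Y ((f.prodCongr (LinearEquiv.refl A X)).trans
      (e.trans (f.symm.prodCongr (LinearEquiv.refl A Y))))
  · intro M hM X Y e
    have := uniqueOfSubsingleton (0 : M)
    exact ⟨LinearEquiv.uniqueProd.symm.trans (e.trans LinearEquiv.uniqueProd)⟩
  · intro M hM X Y e
    exact nonempty_linearEquiv_of_prod_of_isLocalRing e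
  · intro M N hM hN X Y e
    obtain ⟨e₁⟩ := hM (FGModuleCat.of A (N × X)) (FGModuleCat.of A (N × Y))
      ((LinearEquiv.prodAssoc A M N X).symm.trans (e.trans (LinearEquiv.prodAssoc A M N Y)))
    exact hN X Y e₁

/-- Up to isomorphism, a finitely generated module has only finitely many direct summands with
local endomorphism ring. -/
theorem exists_finite_isSummand (M : FGModuleCat.{u} A) :
    ∃ S : Set (FGModuleCat.{u} A), S.Finite ∧ ∀ N : FGModuleCat.{u} A,
      IsLocalRing (Module.End A N) → IsSummand N M → ∃ L ∈ S, Nonempty (N ≃ₗ[A] L) := by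
  refine decomposition_induction (p := fun M => ∃ S : Set (FGModuleCat.{u} A), S.Finite ∧
    ∀ N : FGModuleCat.{u} A, IsLocalRing (Module.End A N) → IsSummand N M →
      ∃ L ∈ S, Nonempty (N ≃ₗ[A] L)) ?_ ?_ ?_ ?_ M
  · rintro M N e ⟨S, hS, h⟩
    exact ⟨S, hS, fun N' hN' hs => h N' hN' (hs.of_equiv e.symm)⟩
  · intro M hM
    refine ⟨∅, Set.finite_empty, fun N hN hs => ?_⟩
    have := nontrivial_of_isLocalRing_end (A := A) (N := N)
    exact absurd hs not_isSummand_of_subsingleton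
  · intro M hM
    refine ⟨{M}, Set.finite_singleton M, fun N hN ⟨N', ⟨e⟩⟩ => ⟨M, rfl, ?_⟩⟩
    have hN' := nontrivial_of_isLocalRing_end (A := A) (N := N)
    rcases subsingleton_or_of_isLocalRing_end e with h | h
    · exact absurd h (not_subsingleton_iff_nontrivial.mpr hN')
    · have := uniqueOfSubsingleton (0 : N')
      exact ⟨(e.trans LinearEquiv.prodUnique).symm⟩
  · rintro M N ⟨S, hS, h⟩ ⟨T, hT, h'⟩
    refine ⟨S ∪ T, hS.union hT, fun L hL hs => ?_⟩
    rcases hs.of_prod_of_isLocalRing (X := M) (Y := N) (LinearEquiv.refl A (M × N)) with hs | hs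
    · obtain ⟨L', hL', e⟩ := h L hL hs
      exact ⟨L', Or.inl hL', e⟩
    · obtain ⟨L', hL', e⟩ := h' L hL hs
      exact ⟨L', Or.inr hL', e⟩

end Decomposition

/-! ### Equality in the group `K₀(A)` -/

section StableIsomorphism

variable {A : Type u} [Ring A]

/-- `M` and `N` are stably isomorphic: they become isomorphic after adding finitely generated
projective modules. -/
def StablyIsomorphic (M N : FGModuleCat.{u} A) : Prop :=
  ∃ P Q : FGModuleCat.{u} A, Module.Projective A P ∧ Module.Projective A Q ∧
    Nonempty ((M × P) ≃ₗ[A] (N × Q))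

theorem StablyIsomorphic.of_equiv {M N : FGModuleCat.{u} A} (e : M ≃ₗ[A] N) :
    StablyIsomorphic M N :=
  ⟨FGModuleCat.of A PUnit.{u + 1}, FGModuleCat.of A PUnit.{u + 1},
    inferInstanceAs (Module.Projective A PUnit.{u + 1}),
    inferInstanceAs (Module.Projective A PUnit.{u + 1}), ⟨e.prodCongr (LinearEquiv.refl A _)⟩⟩

theorem StablyIsomorphic.symm {M N : FGModuleCat.{u} A} (h : StablyIsomorphic M N) :
    StablyIsomorphic N M := by
  obtain ⟨P, Q, hP, hQ, ⟨e⟩⟩ := h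
  exact ⟨Q, P, hQ, hP, ⟨e.symm⟩⟩

theorem projective_prod (P Q : FGModuleCat.{u} A) (hP : Module.Projective A P)
    (hQ : Module.Projective A Q) : Module.Projective A (FGModuleCat.of A (P × Q)) :=
  inferInstanceAs (Module.Projective A (P × Q))

theorem StablyIsomorphic.trans {M N L : FGModuleCat.{u} A} (h : StablyIsomorphic M N)
    (h' : StablyIsomorphic N L) : StablyIsomorphic M L := by
  obtain ⟨P, Q, hP, hQ, ⟨e⟩⟩ := h
  obtain ⟨P', Q', hP', hQ', ⟨e'⟩⟩ := h'
  refine ⟨FGModuleCat.of A (P × P'), FGModuleCat.of A (Q' × Q), projective_prod P P' hP hP',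
    projective_prod Q' Q hQ' hQ, ⟨?_⟩⟩
  -- `M × P × P' ≃ N × Q × P' ≃ N × P' × Q ≃ L × Q' × Q`
  have e₁ : (M × (P × P')) ≃ₗ[A] ((N × Q) × P') :=
    (LinearEquiv.prodAssoc A M P P').symm.trans (e.prodCongr (LinearEquiv.refl A P'))
  have e₂ : ((N × Q) × P') ≃ₗ[A] ((N × P') × Q) :=
    (LinearEquiv.prodAssoc A N Q P').trans
      (((LinearEquiv.refl A N).prodCongr (LinearEquiv.prodComm A Q P')).trans
        (LinearEquiv.prodAssoc A N P' Q).symm)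
  exact (e₁.trans e₂).trans
    ((e'.prodCongr (LinearEquiv.refl A Q)).trans (LinearEquiv.prodAssoc A L Q' Q))

theorem StablyIsomorphic.prod {M N M₁ N₁ : FGModuleCat.{u} A} (h : StablyIsomorphic M N)
    (h' : StablyIsomorphic M₁ N₁) :
    StablyIsomorphic (FGModuleCat.of A (M × M₁)) (FGModuleCat.of A (N × N₁)) := by
  obtain ⟨P, Q, hP, hQ, ⟨e⟩⟩ := h
  obtain ⟨P', Q', hP', hQ', ⟨e'⟩⟩ := h'
  exact ⟨FGModuleCat.of A (P × P'), FGModuleCat.of A (Q × Q'), projective_prod P P' hP hP',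
    projective_prod Q Q' hQ hQ', ⟨(LinearEquiv.prodProdProdComm A M M₁ P P').trans
      ((e.prodCongr e').trans (LinearEquiv.prodProdProdComm A N Q N₁ Q'))⟩⟩

/-- Stable isomorphism of finitely generated modules. -/
def stableSetoid (A : Type u) [Ring A] : Setoid (FGModuleCat.{u} A) where
  r := StablyIsomorphic
  iseqv := ⟨fun M => .of_equiv (LinearEquiv.refl A M), .symm, .trans⟩

/-- The monoid of stable isomorphism classes of finitely generated modules under direct sum. -/
def StableClass (A : Type u) [Ring A] : Type (u + 1) :=
  Quotient (stableSetoid A)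

/-- The stable isomorphism class of a module. -/
def StableClass.mk (M : FGModuleCat.{u} A) : StableClass A :=
  Quotient.mk (stableSetoid A) M

theorem StableClass.mk_eq_iff {M N : FGModuleCat.{u} A} :
    StableClass.mk M = StableClass.mk N ↔ StablyIsomorphic M N :=
  Quotient.eq (r := stableSetoid A)

theorem StableClass.ind {p : StableClass A → Prop} (h : ∀ M, p (.mk M)) (x) : p x :=
  Quotient.ind h x

instance : Add (StableClass A) where
  add := Quotient.map₂ (fun M N => FGModuleCat.of A (M × N)) fun _ _ h _ _ h' => h.prod h'

instance : Zero (StableClass A) where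
  zero := .mk (FGModuleCat.of A PUnit.{u + 1})

theorem StableClass.mk_add_mk (M N : FGModuleCat.{u} A) :
    StableClass.mk M + StableClass.mk N = .mk (FGModuleCat.of A (M × N)) :=
  rfl

theorem StableClass.mk_eq_of_equiv {M N : FGModuleCat.{u} A} (e : M ≃ₗ[A] N) :
    StableClass.mk M = StableClass.mk N :=
  StableClass.mk_eq_iff.mpr (.of_equiv e)

instance : AddCommMonoid (StableClass A) where
  add_assoc x y z := by
    induction x using StableClass.ind with | h M =>
    induction y using StableClass.ind with | h N =>
    induction z using StableClass.ind with | h L =>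
    exact StableClass.mk_eq_of_equiv (LinearEquiv.prodAssoc A M N L)
  zero_add x := by
    induction x using StableClass.ind with | h M =>
    exact StableClass.mk_eq_of_equiv
      (LinearEquiv.uniqueProd (R := A) (M := M) (M₂ := PUnit.{u + 1}))
  add_zero x := by
    induction x using StableClass.ind with | h M =>
    exact StableClass.mk_eq_of_equiv
      (LinearEquiv.prodUnique (R := A) (M := M) (M₂ := PUnit.{u + 1}))
  add_comm x y := by
    induction x using StableClass.ind with | h M =>
    induction y using StableClass.ind with | h N =>
    exact StableClass.mk_eq_of_equiv (LinearEquiv.prodComm A M N)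
  nsmul := nsmulRec

theorem StableClass.mk_projective {P : FGModuleCat.{u} A} (hP : Module.Projective A P) :
    StableClass.mk P = 0 :=
  StableClass.mk_eq_iff.mpr ⟨FGModuleCat.of A PUnit.{u + 1}, P,
    inferInstanceAs (Module.Projective A PUnit.{u + 1}), hP,
    ⟨LinearEquiv.prodComm A P PUnit.{u + 1}⟩⟩

instance [IsArtinianRing A] : IsCancelAdd (StableClass A) :=
  have : IsLeftCancelAdd (StableClass A) := by
    refine ⟨fun x y z h => ?_⟩
    induction x using StableClass.ind with | h M =>
    induction y using StableClass.ind with | h X =>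
    induction z using StableClass.ind with | h Y =>
    obtain ⟨P, Q, hP, hQ, ⟨e⟩⟩ := StableClass.mk_eq_iff.mp h
    obtain ⟨e'⟩ := nonempty_linearEquiv_of_prod M (FGModuleCat.of A (X × P))
      (FGModuleCat.of A (Y × Q)) ((LinearEquiv.prodAssoc A M X P).symm.trans
        (e.trans (LinearEquiv.prodAssoc A M Y Q)))
    exact StableClass.mk_eq_iff.mpr ⟨P, Q, hP, hQ, ⟨e'⟩⟩
  AddCommMagma.IsLeftCancelAdd.toIsCancelAdd _

/-- The map from `K₀(A)` to the group completion of the monoid of stable isomorphism classes. -/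
def K₀.toStable (A : Type u) [Ring A] :
    K₀ A →+ Algebra.GrothendieckAddGroup (StableClass A) :=
  QuotientAddGroup.lift _ (FreeAbelianGroup.lift fun M =>
      Algebra.GrothendieckAddGroup.of (StableClass.mk M)) <| by
    rw [AddSubgroup.closure_le]
    rintro _ (⟨M, M', M'', e⟩ | ⟨P, hP⟩)
    · change FreeAbelianGroup.lift _ _ = 0
      rw [map_sub, map_sub, FreeAbelianGroup.lift_apply_of, FreeAbelianGroup.lift_apply_of,
        FreeAbelianGroup.lift_apply_of, sub_sub, sub_eq_zero, ← map_add, StableClass.mk_add_mk]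
      exact congrArg _ (StableClass.mk_eq_of_equiv e)
    · change FreeAbelianGroup.lift _ _ = 0
      rw [FreeAbelianGroup.lift_apply_of, StableClass.mk_projective hP, map_zero]

theorem K₀.toStable_mk (M : FGModuleCat.{u} A) :
    K₀.toStable A (K₀.mk M) = Algebra.GrothendieckAddGroup.of (StableClass.mk M) :=
  FreeAbelianGroup.lift_apply_of _ _

/-- Modules with the same class in `K₀(A)` are stably isomorphic, since finitely generated modules
can be cancelled. -/
theorem stablyIsomorphic_of_mk_eq [IsArtinianRing A] {M N : FGModuleCat.{u} A}
    (h : K₀.mk M = K₀.mk N) : StablyIsomorphic M N := by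
  have h' := congrArg (K₀.toStable A) h
  rw [K₀.toStable_mk, K₀.toStable_mk] at h'
  exact StableClass.mk_eq_iff.mp (Algebra.GrothendieckAddGroup.of_injective h')

theorem K₀.mk_prod (M N : FGModuleCat.{u} A) :
    K₀.mk (FGModuleCat.of A (M × N)) = K₀.mk M + K₀.mk N :=
  K₀.mk_sum (LinearEquiv.refl A (M × N))

end StableIsomorphism

/-! ### The subgroups `⟨add M⟩` and the function `φ` -/

section Phi

variable {A : Type u} [Ring A] [IsArtinianRing A]

theorem mk_mem_addSubgroup {N M : FGModuleCat.{u} A} (h : IsSummand N M) :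
    K₀.mk N ∈ addSubgroup M := by
  revert h
  refine decomposition_induction (p := fun N => IsSummand N M → K₀.mk N ∈ addSubgroup M)
    ?_ ?_ ?_ ?_ N
  · rintro L N e h ⟨N', ⟨e'⟩⟩
    rw [← K₀.mk_congr e]
    exact h ⟨N', ⟨e'.trans (e.symm.prodCongr (LinearEquiv.refl A N'))⟩⟩
  · intro L hL _
    rw [K₀.mk_projective (P := L) inferInstance]
    exact zero_mem _
  · intro L hL h
    exact AddSubgroup.subset_closure ⟨L, indecomposable_of_isLocalRing_end L, h, rfl⟩
  · intro L N hL hN h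
    rw [K₀.mk_prod]
    exact add_mem (hL ((isSummand_prod_left L N).trans h)) (hN ((isSummand_prod_right L N).trans h))

theorem addSubgroup_fg (M : FGModuleCat.{u} A) : (addSubgroup M).FG := by
  obtain ⟨S, hS, h⟩ := exists_finite_isSummand M
  rw [AddSubgroup.fg_iff]
  refine ⟨_, rfl, (hS.image K₀.mk).subset ?_⟩
  rintro _ ⟨N, hN, hs, rfl⟩
  obtain ⟨L, hL, ⟨e⟩⟩ := h N (isLocalRing_end_of_indecomposable hN) hs
  exact ⟨L, hL, (K₀.mk_congr e).symm⟩

/-- The minimum defining `φ(M)` is attained: the kernels of the powers of `Ω̄` on the finitely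
generated abelian group `⟨add M⟩` stabilise. -/
theorem injOn_syzygyHom_phi (M : FGModuleCat.{u} A) (s : ℕ) :
    Set.InjOn (syzygyHom (A := A))
      ((syzygyHom (A := A))^[phi M + s] '' (addSubgroup M : Set (K₀ A))) := by
  refine Nat.sInf_mem (s := {l : ℕ | ∀ s : ℕ, Set.InjOn (syzygyHom (A := A))
    ((syzygyHom (A := A))^[l + s] '' (addSubgroup M : Set (K₀ A)))}) ?_ s
  let T : Module.End ℤ (K₀ A) := (syzygyHom (A := A)).toIntLinearMap
  let G : Submodule ℤ (K₀ A) := AddSubgroup.toIntSubmodule (addSubgroup M)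
  have : Module.Finite ℤ G :=
    Module.Finite.iff_fg.mpr (by
      rw [Submodule.fg_iff_addSubgroup_fg]
      exact addSubgroup_fg M)
  let F : ℕ →o Submodule ℤ G :=
    ⟨fun n => (LinearMap.ker (T ^ n)).comap G.subtype, monotone_nat_of_le_succ fun n x hx => by
      simp only [Submodule.mem_comap, LinearMap.mem_ker] at hx ⊢
      rw [pow_succ', Module.End.mul_apply, hx, map_zero]⟩
  obtain ⟨l, hl⟩ := monotone_stabilizes_iff_noetherian.mpr (inferInstanceAs (IsNoetherian ℤ G)) F
  have hpow : ∀ (n : ℕ) (x : K₀ A), (syzygyHom (A := A))^[n] x = (T ^ n) x := fun n x =>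
    (Module.End.pow_apply T n x).symm
  refine ⟨l, fun s => ?_⟩
  rintro _ ⟨x, hx, rfl⟩ _ ⟨y, hy, rfl⟩ hxy
  rw [← Function.iterate_succ_apply' (f := syzygyHom (A := A)),
    ← Function.iterate_succ_apply' (f := syzygyHom (A := A)), hpow, hpow, ← sub_eq_zero,
    ← map_sub] at hxy
  rw [hpow, hpow, ← sub_eq_zero, ← map_sub]
  have h1 : (⟨x - y, sub_mem hx hy⟩ : G) ∈ F (l + s + 1) := hxy
  rw [← hl _ (by omega), hl (l + s) (by omega)] at h1
  exact h1

/-- A class in `⟨add M⟩` killed by some power of `Ω̄` is killed by the `φ(M)`-th power. -/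
theorem iterate_phi_eq_zero {M : FGModuleCat.{u} A} {x : K₀ A} (hx : x ∈ addSubgroup M) {s : ℕ}
    (h : (syzygyHom (A := A))^[phi M + s] x = 0) : (syzygyHom (A := A))^[phi M] x = 0 := by
  induction s with
  | zero => exact h
  | succ s ih =>
    refine ih (injOn_syzygyHom_phi M s ⟨x, hx, rfl⟩ ⟨0, zero_mem _, iterate_map_zero _ _⟩ ?_)
    rw [map_zero, ← Function.iterate_succ_apply' (f := syzygyHom (A := A))]
    exact h

theorem mk_iteratedSyzygy (n : ℕ) (M : FGModuleCat.{u} A) :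
    K₀.mk (iteratedSyzygy n M) = (syzygyHom (A := A))^[n] (K₀.mk M) := by
  induction n with
  | zero => rfl
  | succ n ih =>
    rw [Function.iterate_succ_apply', ← ih, syzygyHom_mk, iteratedSyzygy, iteratedSyzygy,
      Function.iterate_succ_apply']

end Phi

/-! ### Projective dimension -/

section ProjectiveDimension

variable {A : Type u} [Ring A]

theorem pd_le_iff (M : FGModuleCat.{u} A) (n : ℕ) :
    pd M ≤ n ↔ HasProjectiveDimensionLE M.obj n := by
  rw [← projectiveDimension_le_iff, pd]
  exact WithBot.unbotD_le_iff fun _ => bot_le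

theorem pd_congr {M N : FGModuleCat.{u} A} (e : M ≃ₗ[A] N) : pd M = pd N := by
  rw [pd, pd, projectiveDimension_eq_of_iso (X := M.obj) (Y := N.obj) e.toModuleIso]

theorem pd_eq_zero_of_projective {P : FGModuleCat.{u} A} (hP : Module.Projective A P) :
    pd P = 0 := by
  have h : Projective P.obj := (IsProjective.iff_projective (P : Type u)).mp hP
  exact nonpos_iff_eq_zero.mp ((pd_le_iff P 0).mpr inferInstance)

theorem projective_of_pd_le_zero {P : FGModuleCat.{u} A} (h : pd P ≤ 0) :
    Module.Projective A P := by
  have h1 := (pd_le_iff P 0).mp h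
  exact (IsProjective.iff_projective (P : Type u)).mpr
    ((projective_iff_hasProjectiveDimensionLE_zero _).mpr h1)

theorem pd_le_of_isSummand {N M : FGModuleCat.{u} A} (h : IsSummand N M) : pd N ≤ pd M := by
  obtain ⟨N', ⟨e⟩⟩ := h
  have r : Retract N.obj M.obj :=
    { i := ModuleCat.ofHom (e.symm.toLinearMap ∘ₗ LinearMap.inl A N N')
      r := ModuleCat.ofHom (LinearMap.fst A N N' ∘ₗ e.toLinearMap)
      retract := by ext x; simp }
  exact (WithBot.unbotD_le_iff fun _ => bot_le).mpr (r.projectiveDimension_le.trans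
    ((WithBot.unbotD_le_iff fun _ => bot_le).mp le_rfl))

theorem pd_prod_le {M N : FGModuleCat.{u} A} {b : ℕ∞} (hM : pd M ≤ b) (hN : pd N ≤ b) :
    pd (FGModuleCat.of A (M × N)) ≤ b := by
  induction b using ENat.recTopCoe with
  | top => exact le_top
  | coe n =>
    rw [pd_le_iff] at hM hN ⊢
    exact hasProjectiveDimensionLT_of_iso (ModuleCat.biprodIsoProd M.obj N.obj) (n + 1)

/-- The short complex of modules given by an exact pair of linear maps. -/
abbrev shortComplexOfExact {X Y Z : Type u} [AddCommGroup X] [Module A X] [AddCommGroup Y]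
    [Module A Y] [AddCommGroup Z] [Module A Z] (f : X →ₗ[A] Y) (g : Y →ₗ[A] Z)
    (h : Function.Exact f g) : ShortComplex (ModuleCat.{u} A) :=
  ShortComplex.mk (ModuleCat.ofHom f) (ModuleCat.ofHom g) (by
    ext x; exact h.apply_apply_eq_zero x)

theorem shortExact_shortComplexOfExact {X Y Z : Type u} [AddCommGroup X] [Module A X]
    [AddCommGroup Y] [Module A Y] [AddCommGroup Z] [Module A Z] (f : X →ₗ[A] Y) (g : Y →ₗ[A] Z)
    (h : Function.Exact f g) (hf : Function.Injective f) (hg : Function.Surjective g) :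
    (shortComplexOfExact f g h).ShortExact := by
  have := (ModuleCat.mono_iff_injective (ModuleCat.ofHom f)).mpr hf
  have := (ModuleCat.epi_iff_surjective (ModuleCat.ofHom g)).mpr hg
  exact
    { exact := (ShortComplex.ShortExact.moduleCat_exact_iff_function_exact _).mpr h
      mono_f := ‹_›
      epi_g := ‹_› }

/-- Dimension shifting along an epimorphism from a projective module. -/
theorem pd_le_succ_iff_pd_ker_le [IsArtinianRing A] {P M : FGModuleCat.{u} A}
    (hP : Module.Projective A P) (π : P →ₗ[A] M) (hπ : Function.Surjective π) (n : ℕ) :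
    pd M ≤ (n + 1 : ℕ) ↔ pd (FGModuleCat.of A (LinearMap.ker π)) ≤ n := by
  rw [pd_le_iff, pd_le_iff]
  have h := shortExact_shortComplexOfExact (LinearMap.ker π).subtype π
    (LinearMap.exact_subtype_ker_map π) (Submodule.injective_subtype _) hπ
  exact h.hasProjectiveDimensionLT_X₃_iff n ((IsProjective.iff_projective (P : Type u)).mp hP)

end ProjectiveDimension

section Fitting

variable {A : Type u} [Ring A]

/-- An endomorphism `f` of a module `X` of finite length becomes invertible after adding the
projection onto a direct summand `Z` of `X` on which `f` is nilpotent. -/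
theorem exists_fitting_summand {X : Type u} [AddCommGroup X] [Module A X] [IsArtinian A X]
    [IsNoetherian A X] (f : Module.End A X) :
    ∃ (Z : Submodule A X) (p : X →ₗ[A] Z) (n : ℕ), p ∘ₗ Z.subtype = LinearMap.id ∧
      p ∘ₗ (f ^ n) = 0 ∧ IsUnit (f + Z.subtype ∘ₗ p) := by
  obtain ⟨n, hn, hpos⟩ := (f.eventually_isCompl_ker_pow_range_pow.and
    (Filter.eventually_ge_atTop 1)).exists
  let Z := LinearMap.ker (f ^ n)
  let p : X →ₗ[A] Z := Submodule.projectionOnto Z (LinearMap.range (f ^ n)) hn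
  have hpZ : ∀ z : Z, p z = z := fun z => Submodule.projectionOnto_apply_left hn z
  refine ⟨Z, p, n, LinearMap.ext hpZ, ?_, ?_⟩
  · ext x
    have : p ((f ^ n) x) = 0 := Submodule.projectionOnto_apply_of_mem_right hn ⟨x, rfl⟩
    simp [this]
  · have hinj : Function.Injective (f + Z.subtype ∘ₗ p) := by
      rw [injective_iff_map_eq_zero]
      intro x hx
      have hfx : f x = -(p x : X) := eq_neg_of_add_eq_zero_left hx
      -- `f x` lies in `Z`, hence so does `x`, because `ker f ^ (2 * n) = ker f ^ n`
      have h1 : (f ^ n) (f x) = 0 := by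
        rw [hfx, map_neg, neg_eq_zero]
        exact (p x).2
      have h2 : (f ^ n) ((f ^ n) x) = 0 := by
        obtain ⟨m, rfl⟩ : ∃ m, n = m + 1 := ⟨n - 1, by omega⟩
        rw [← Module.End.mul_apply, ← pow_add, show m + 1 + (m + 1) = m + ((m + 1) + 1) by omega,
          pow_add, pow_succ f (m + 1), Module.End.mul_apply, Module.End.mul_apply, h1, map_zero]
      have h3 : (f ^ n) x = 0 := by
        have : (f ^ n) x ∈ Z ⊓ LinearMap.range (f ^ n) := ⟨h2, x, rfl⟩
        rwa [hn.inf_eq_bot] at this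
      have h4 : (p x : X) = x := congrArg Subtype.val (hpZ ⟨x, h3⟩)
      rw [h4] at hfx
      have h5 : ∀ m : ℕ, (f ^ m) x = (-1 : ℤ) ^ m • x := fun m => by
        induction m with
        | zero => simp
        | succ m ih =>
          rw [pow_succ', Module.End.mul_apply, ih, map_zsmul, hfx, pow_succ, mul_smul, neg_smul,
            one_smul]
      rw [h5] at h3
      rcases neg_one_pow_eq_or ℤ n with h | h <;> simpa [h] using h3
    exact (Module.End.isUnit_iff _).mpr
      ⟨hinj, IsArtinian.surjective_of_injective_endomorphism _ hinj⟩

end Fitting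

section SelfExtension

open Abelian

variable {A : Type u} [Ring A] [IsArtinianRing A]

/-- If `D` is the cokernel of a monomorphism `X → X × P` with `P` projective, then the Fitting
decomposition of the entry `f : X → X` splits off a summand `Z` of `X` on which `f` is nilpotent.
In high degrees `f` is injective on `Ext(X, -)`, so that `Ext(Z, -)` vanishes there; as soon as
`Ext(Z, -)` vanishes, `f` is bijective on `Ext(X, -)` and the long exact sequence bounds the
projective dimension of `D`. -/
theorem exists_isSummand_pd_le_pd_add_one {X P D : FGModuleCat.{u} A}
    (hP : Module.Projective A P) (α : X →ₗ[A] (X × P)) (β : (X × P) →ₗ[A] D)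
    (hα : Function.Injective α) (hαβ : Function.Exact α β) (hβ : Function.Surjective β)
    (hD : pd D ≠ ⊤) : ∃ Z : FGModuleCat.{u} A, IsSummand Z X ∧ pd Z ≠ ⊤ ∧ pd D ≤ pd Z + 1 := by
  have hP' : Projective (ModuleCat.of A P) := (IsProjective.iff_projective (P : Type u)).mp hP
  let S := shortComplexOfExact α β hαβ
  have hS : S.ShortExact := shortExact_shortComplexOfExact α β hαβ hα hβ
  let f : Module.End A X := LinearMap.fst A X P ∘ₗ α
  obtain ⟨Z, p, n, hp, hpf, hu⟩ := exists_fitting_summand f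
  let inl : ModuleCat.of A X ⟶ S.X₂ := ModuleCat.ofHom (LinearMap.inl A X P)
  let inr : ModuleCat.of A P ⟶ S.X₂ := ModuleCat.ofHom (LinearMap.inr A X P)
  let fst : S.X₂ ⟶ ModuleCat.of A X := ModuleCat.ofHom (LinearMap.fst A X P)
  let snd : S.X₂ ⟶ ModuleCat.of A P := ModuleCat.ofHom (LinearMap.snd A X P)
  let F : ModuleCat.of A X ⟶ ModuleCat.of A X := ModuleCat.ofHom f
  let i : ModuleCat.of A Z ⟶ ModuleCat.of A X := ModuleCat.ofHom Z.subtype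
  let q : ModuleCat.of A X ⟶ ModuleCat.of A Z := ModuleCat.ofHom p
  have hSF : S.f ≫ fst = F := rfl
  have hinl : inl ≫ fst = 𝟙 _ := rfl
  have hiq : i ≫ q = 𝟙 _ := ModuleCat.hom_ext hp
  have hsum : fst ≫ inl + snd ≫ inr = 𝟙 S.X₂ := by
    refine ModuleCat.hom_ext (LinearMap.ext fun (x : X × P) => ?_)
    change ((x.1, 0) + (0, x.2) : X × P) = x
    simp
  -- in positive degrees the classes on `X × P` come from `X`
  have hfst : ∀ {Y : ModuleCat.{u} A} {k : ℕ} (_ : 1 ≤ k) (x : Ext S.X₂ Y k),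
      (Ext.mk₀ fst).comp ((Ext.mk₀ inl).comp x (zero_add k)) (zero_add k) = x := by
    intro Y k hk x
    have h0 : (Ext.mk₀ inr).comp x (zero_add k) = 0 :=
      Ext.eq_zero_of_hasProjectiveDimensionLT _ 1 hk
    have h1 : (Ext.mk₀ (fst ≫ inl + snd ≫ inr)).comp x (zero_add k) = x := by
      rw [hsum, Ext.mk₀_id_comp]
    rw [Ext.mk₀_add, Ext.add_comp, ← Ext.mk₀_comp_mk₀_assoc, ← Ext.mk₀_comp_mk₀_assoc, h0,
      Ext.comp_zero, add_zero] at h1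
    exact h1
  -- `f` and the invertible endomorphism `f + i p` agree where `Ext(Z, -)` vanishes
  obtain ⟨v, hv⟩ := hu
  let V : ModuleCat.of A X ⟶ ModuleCat.of A X := ModuleCat.ofHom v⁻¹.1
  have hVF : V ≫ (F + q ≫ i) = 𝟙 _ := by
    refine ModuleCat.hom_ext ?_
    change (f + Z.subtype ∘ₗ p) * v⁻¹.1 = 1
    rw [← hv]; exact v.mul_inv
  have hFV : (F + q ≫ i) ≫ V = 𝟙 _ := by
    refine ModuleCat.hom_ext ?_
    change v⁻¹.1 * (f + Z.subtype ∘ₗ p) = 1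
    rw [← hv]; exact v.inv_mul
  have hFu : ∀ {m : ℕ} (_ : HasProjectiveDimensionLT (ModuleCat.of A Z) m)
      {Y : ModuleCat.{u} A} {k : ℕ} (_ : m ≤ k) (x : Ext (ModuleCat.of A X) Y k),
      (Ext.mk₀ (F + q ≫ i)).comp x (zero_add k) = (Ext.mk₀ F).comp x (zero_add k) := by
    intro m hm Y k hk x
    rw [Ext.mk₀_add, Ext.add_comp, ← Ext.mk₀_comp_mk₀_assoc,
      Ext.eq_zero_of_hasProjectiveDimensionLT ((Ext.mk₀ i).comp x (zero_add k)) m hk,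
      Ext.comp_zero, add_zero]
  have hZD : ∀ d : ℕ, HasProjectiveDimensionLT D.obj (d + 1) →
      HasProjectiveDimensionLT (ModuleCat.of A Z) (d + 1) := by
    intro d hd
    refine HasProjectiveDimensionLT.mk fun k hk Y e => ?_
    have hinj : ∀ x : Ext (ModuleCat.of A X) Y k,
        (Ext.mk₀ F).comp x (zero_add k) = 0 → x = 0 := by
      intro x hx
      rw [← hSF, ← Ext.mk₀_comp_mk₀_assoc] at hx
      obtain ⟨y, hy⟩ := Ext.contravariant_sequence_exact₂ hS _ _ hx
      rw [Ext.eq_zero_of_hasProjectiveDimensionLT (X := D.obj) y (d + 1) hk, Ext.comp_zero] at hy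
      rw [← Ext.mk₀_id_comp x, ← hinl, ← Ext.mk₀_comp_mk₀_assoc, ← hy, Ext.comp_zero]
    have hpow : ∀ (m : ℕ) (x : Ext (ModuleCat.of A X) Y k),
        (Ext.mk₀ (ModuleCat.ofHom (f ^ m) : ModuleCat.of A X ⟶ ModuleCat.of A X)).comp x
          (zero_add k) = 0 → x = 0 := by
      intro m
      induction m with
      | zero =>
        intro x hx
        rwa [show (ModuleCat.ofHom (f ^ 0) : ModuleCat.of A X ⟶ ModuleCat.of A X) = 𝟙 _ from rfl,
          Ext.mk₀_id_comp] at hx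
      | succ m ih =>
        intro x hx
        rw [show (ModuleCat.ofHom (f ^ (m + 1)) : ModuleCat.of A X ⟶ ModuleCat.of A X) =
          ModuleCat.ofHom (f ^ m) ≫ F by rw [pow_succ']; rfl, ← Ext.mk₀_comp_mk₀_assoc] at hx
        exact hinj x (ih _ hx)
    have hq : (Ext.mk₀ q).comp e (zero_add k) = 0 := by
      refine hpow n _ ?_
      rw [Ext.mk₀_comp_mk₀_assoc,
        show (ModuleCat.ofHom (f ^ n) : ModuleCat.of A X ⟶ ModuleCat.of A X) ≫ q = 0 from
          ModuleCat.hom_ext hpf, Ext.mk₀_zero, Ext.zero_comp]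
    rw [← Ext.mk₀_id_comp e, ← hiq, ← Ext.mk₀_comp_mk₀_assoc, hq, Ext.comp_zero]
  have hDZ : ∀ m : ℕ, HasProjectiveDimensionLT (ModuleCat.of A Z) (m + 1) →
      HasProjectiveDimensionLT D.obj (m + 1 + 1) := by
    intro m hm
    refine HasProjectiveDimensionLT.mk fun j hj Y e => ?_
    obtain ⟨k, rfl⟩ : ∃ k, j = 1 + k := ⟨j - 1, by omega⟩
    have hβe : (Ext.mk₀ S.g).comp e (zero_add _) = 0 := by
      have h1 : (Ext.mk₀ F).comp ((Ext.mk₀ inl).comp ((Ext.mk₀ S.g).comp e (zero_add _))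
          (zero_add _)) (zero_add _) = 0 := by
        rw [← hSF, ← Ext.mk₀_comp_mk₀_assoc, hfst (by omega), Ext.mk₀_comp_mk₀_assoc, S.zero,
          Ext.mk₀_zero, Ext.zero_comp]
      rw [← hFu hm (by omega)] at h1
      have h2 := congrArg (fun x => (Ext.mk₀ V).comp x (zero_add _)) h1
      simp only [Ext.comp_zero] at h2
      rw [Ext.mk₀_comp_mk₀_assoc, hVF, Ext.mk₀_id_comp] at h2
      rw [← hfst (by omega) ((Ext.mk₀ S.g).comp e (zero_add _)), h2, Ext.comp_zero]
    obtain ⟨x, hx⟩ := Ext.contravariant_sequence_exact₃ hS _ e hβe (n₀ := k) rfl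
    have h3 : (Ext.mk₀ S.f).comp ((Ext.mk₀ fst).comp ((Ext.mk₀ V).comp x (zero_add k))
        (zero_add k)) (zero_add k) = x := by
      rw [Ext.mk₀_comp_mk₀_assoc, hSF, ← hFu hm (by omega), Ext.mk₀_comp_mk₀_assoc, hFV,
        Ext.mk₀_id_comp]
    rw [← hx, ← h3, ShortComplex.ShortExact.extClass_comp_assoc]
  obtain ⟨d, hd⟩ := ENat.ne_top_iff_exists.mp hD
  have hZd : pd (FGModuleCat.of A Z) ≤ d :=
    (pd_le_iff _ d).mpr (hZD d ((pd_le_iff D d).mp hd.symm.le))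
  have hZ : pd (FGModuleCat.of A Z) ≠ ⊤ := ne_top_of_le_ne_top (ENat.natCast_ne_top d) hZd
  refine ⟨FGModuleCat.of A Z, isSummand_of_retract Z.subtype p hp, hZ, ?_⟩
  obtain ⟨m, hm⟩ := ENat.ne_top_iff_exists.mp hZ
  rw [← hm]
  exact (pd_le_iff D (m + 1)).mpr (hDZ m ((pd_le_iff (FGModuleCat.of A Z) m).mp hm.symm.le))

end SelfExtension

/-! ### Syzygies of short exact sequences -/

section Horseshoe

variable {A : Type u} [Ring A] [IsArtinianRing A]

/-- The horseshoe lemma for one syzygy, with the middle and left terms recorded by their classes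
in `K₀(A)`. -/
theorem exists_exact_syzygy {M' M M'' : FGModuleCat.{u} A} (f : M' →ₗ[A] M) (g : M →ₗ[A] M'')
    (hf : Function.Injective f) (hfg : Function.Exact f g) (hg : Function.Surjective g) :
    ∃ (K' K K'' : FGModuleCat.{u} A) (f₁ : K' →ₗ[A] K) (g₁ : K →ₗ[A] K''),
      Function.Injective f₁ ∧ Function.Exact f₁ g₁ ∧ Function.Surjective g₁ ∧
      K₀.mk K' = syzygyHom (K₀.mk M') ∧ K₀.mk K = syzygyHom (K₀.mk M) ∧
      ∀ n : ℕ, pd M'' ≤ (n + 1 : ℕ) ↔ pd K'' ≤ n := by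
  have hp' := isProjectiveCover_projectiveCoverMap M'
  have hp'' := isProjectiveCover_projectiveCoverMap M''
  have hP' : Module.Projective A (projectiveCover M') := hp'.projective
  have hP'' : Module.Projective A (projectiveCover M'') := hp''.projective
  let p' := projectiveCoverMap M'
  let p'' := projectiveCoverMap M''
  obtain ⟨t, ht⟩ := Module.projective_lifting_property g p'' hg
  have ht' : ∀ x, g (t x) = p'' x := fun x => LinearMap.congr_fun ht x
  let P : FGModuleCat.{u} A := FGModuleCat.of A (projectiveCover M' × projectiveCover M'')
  let h : (projectiveCover M' × projectiveCover M'') →ₗ[A] M := (f ∘ₗ p').coprod t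
  have hval : ∀ x, h x = f (p' x.1) + t x.2 := fun x => rfl
  have hgh : ∀ x, g (h x) = p'' x.2 := fun x => by
    rw [hval, map_add, hfg.apply_apply_eq_zero, zero_add, ht']
  have hsurj : Function.Surjective h := by
    intro m
    obtain ⟨y, hy⟩ := hp''.surjective (g m)
    have h1 : g (m - t y) = 0 := by rw [map_sub, ht', sub_eq_zero]; exact hy.symm
    obtain ⟨m', hm'⟩ := (hfg _).mp h1
    obtain ⟨x, hx⟩ := hp'.surjective m'
    refine ⟨(x, y), ?_⟩
    rw [hval, show p' x = m' from hx, hm', sub_add_cancel]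
  let f₁ : LinearMap.ker p' →ₗ[A] LinearMap.ker h :=
    ((LinearMap.inl A _ _) ∘ₗ (LinearMap.ker p').subtype).codRestrict _ fun x => by
      have : p' x.1 = 0 := x.2
      rw [LinearMap.mem_ker, hval]
      simp [this]
  let g₁ : LinearMap.ker h →ₗ[A] LinearMap.ker p'' :=
    ((LinearMap.snd A _ _) ∘ₗ (LinearMap.ker h).subtype).codRestrict _ fun x => by
      have h1 : h x.1 = 0 := x.2
      rw [LinearMap.mem_ker]
      change p'' x.1.2 = 0
      rw [← hgh, h1, map_zero]
  refine ⟨syzygy M', FGModuleCat.of A (LinearMap.ker h), syzygy M'', f₁, g₁, ?_, ?_, ?_,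
    (syzygyHom_mk M').symm, ?_, ?_⟩
  · intro x y hxy
    exact Subtype.ext (congrArg (fun z => z.1.1) hxy)
  · rintro ⟨⟨x, y⟩, hxy⟩
    constructor
    · intro h0
      have hy : y = 0 := congrArg Subtype.val h0
      subst hy
      have hx : p' x = 0 := by
        rw [LinearMap.mem_ker, hval] at hxy
        simp only [map_zero, add_zero] at hxy
        exact hf (hxy.trans (map_zero f).symm)
      exact ⟨⟨x, hx⟩, rfl⟩
    · rintro ⟨z, hz⟩
      refine Subtype.ext ?_
      exact (congrArg (fun z => z.1.2) hz).symm
  · rintro ⟨y, hy⟩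
    have h1 : g (-t y) = 0 := by rw [map_neg, ht', neg_eq_zero]; exact hy
    obtain ⟨m', hm'⟩ := (hfg _).mp h1
    obtain ⟨x, hx⟩ := hp'.surjective m'
    refine ⟨⟨(x, y), ?_⟩, rfl⟩
    rw [LinearMap.mem_ker, hval, show p' x = m' from hx, hm', neg_add_cancel]
  · rw [syzygyHom_mk]
    exact K₀.mk_ker M P (inferInstanceAs (Module.Projective A
      (projectiveCover M' × projectiveCover M''))) h hsurj
  · exact pd_le_succ_iff_pd_ker_le hP'' p'' hp''.surjective

/-- The iterated form of `exists_exact_syzygy`. -/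
theorem exists_exact_iterate {M' M M'' : FGModuleCat.{u} A} (f : M' →ₗ[A] M) (g : M →ₗ[A] M'')
    (hf : Function.Injective f) (hfg : Function.Exact f g) (hg : Function.Surjective g) (r : ℕ) :
    ∃ (K' K K'' : FGModuleCat.{u} A) (f₁ : K' →ₗ[A] K) (g₁ : K →ₗ[A] K''),
      Function.Injective f₁ ∧ Function.Exact f₁ g₁ ∧ Function.Surjective g₁ ∧
      K₀.mk K' = (syzygyHom (A := A))^[r] (K₀.mk M') ∧
      K₀.mk K = (syzygyHom (A := A))^[r] (K₀.mk M) ∧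
      ∀ n : ℕ, pd M'' ≤ (n + r : ℕ) ↔ pd K'' ≤ n := by
  induction r with
  | zero => exact ⟨M', M, M'', f, g, hf, hfg, hg, rfl, rfl, fun n => Iff.rfl⟩
  | succ r ih =>
    obtain ⟨K', K, K'', f₁, g₁, hf₁, hfg₁, hg₁, h', h, hpd⟩ := ih
    obtain ⟨L', L, L'', f₂, g₂, hf₂, hfg₂, hg₂, k', k, kpd⟩ :=
      exists_exact_syzygy f₁ g₁ hf₁ hfg₁ hg₁
    refine ⟨L', L, L'', f₂, g₂, hf₂, hfg₂, hg₂, ?_, ?_, fun n => ?_⟩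
    · rw [k', h', Function.iterate_succ_apply']
    · rw [k, h, Function.iterate_succ_apply']
    · rw [← kpd, ← hpd, add_assoc, add_comm 1 r]

theorem mk_eq_of_exact_of_projective {M' M M'' : FGModuleCat.{u} A} (f : M' →ₗ[A] M)
    (g : M →ₗ[A] M'') (hf : Function.Injective f) (hfg : Function.Exact f g)
    (hg : Function.Surjective g) (h : Module.Projective A M'') : K₀.mk M' = K₀.mk M := by
  obtain ⟨s, hs⟩ := Module.projective_lifting_property g LinearMap.id hg
  have e : M ≃ₗ[A] (M'' × LinearMap.ker g) := prodKerEquivOfRetract s g hs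
  have e' : M' ≃ₗ[A] LinearMap.ker g :=
    (LinearEquiv.ofInjective f hf).trans (LinearEquiv.ofEq _ _ hfg.linearMap_ker_eq.symm)
  rw [K₀.mk_sum (M := M) (M' := M'') (M'' := FGModuleCat.of A (LinearMap.ker g)) e,
    K₀.mk_projective h, zero_add]
  exact K₀.mk_congr (M := M') (N := FGModuleCat.of A (LinearMap.ker g)) e'

end Horseshoe

/-! ### Finite projective dimensions of summands -/

section Summands

variable {A : Type u} [Ring A] [IsArtinianRing A]

/-- The finite projective dimensions of the direct summands of a module are bounded, because the
projective dimension of a summand is the maximum of those of its indecomposable summands. -/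
theorem iSup_pd_summand_ne_top (W : FGModuleCat.{u} A) :
    (⨆ (N : FGModuleCat.{u} A) (_ : IsSummand N W) (_ : pd N ≠ ⊤), pd N) ≠ ⊤ := by
  obtain ⟨S, hS, h⟩ := exists_finite_isSummand W
  obtain ⟨b, hb⟩ := (hS.image fun L => (pd L).toNat).bddAbove
  refine ne_top_of_le_ne_top (ENat.natCast_ne_top b)
    (iSup_le fun N => iSup_le fun hN => iSup_le fun hpd => ?_)
  revert hN hpd
  refine decomposition_induction (p := fun N => IsSummand N W → pd N ≠ ⊤ → pd N ≤ b)
    ?_ ?_ ?_ ?_ N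
  · rintro L N e h ⟨N', ⟨e'⟩⟩ hpd
    rw [← pd_congr e] at hpd ⊢
    exact h ⟨N', ⟨e'.trans (e.symm.prodCongr (LinearEquiv.refl A N'))⟩⟩ hpd
  · intro L hL _ _
    rw [pd_eq_zero_of_projective (P := L) inferInstance]
    exact bot_le
  · intro N hN hs hpd
    obtain ⟨L, hL, ⟨e⟩⟩ := h N hN hs
    rw [pd_congr e] at hpd ⊢
    rw [← ENat.natCast_toNat hpd]
    exact Nat.cast_le.mpr (hb ⟨L, hL, rfl⟩)
  · intro L N hL hN hs hpd
    have h₁ := isSummand_prod_left L N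
    have h₂ := isSummand_prod_right L N
    exact pd_prod_le (hL (h₁.trans hs) (ne_top_of_le_ne_top hpd (pd_le_of_isSummand h₁)))
      (hN (h₂.trans hs) (ne_top_of_le_ne_top hpd (pd_le_of_isSummand h₂)))

/-- If `[X] + [Y] = [W]` in `K₀(A)`, then `X ⊕ Y` and `W` are stably isomorphic, hence every
nonprojective indecomposable summand of `X` is a summand of `W`. The projective summands contribute
`0` to the projective dimension. -/
theorem pd_le_iSup_of_mk_add_eq {Z X Y W : FGModuleCat.{u} A} (hZ : IsSummand Z X)
    (hW : K₀.mk X + K₀.mk Y = K₀.mk W) (hpd : pd Z ≠ ⊤) :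
    pd Z ≤ ⨆ (N : FGModuleCat.{u} A) (_ : IsSummand N W) (_ : pd N ≠ ⊤), pd N := by
  rw [← K₀.mk_prod] at hW
  obtain ⟨P, Q, hP, hQ, ⟨e⟩⟩ := stablyIsomorphic_of_mk_eq hW
  revert hZ hpd
  refine decomposition_induction (p := fun Z => IsSummand Z X → pd Z ≠ ⊤ →
    pd Z ≤ ⨆ (N : FGModuleCat.{u} A) (_ : IsSummand N W) (_ : pd N ≠ ⊤), pd N) ?_ ?_ ?_ ?_ Z
  · rintro L N e h ⟨N', ⟨e'⟩⟩ hpd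
    rw [← pd_congr e] at hpd ⊢
    exact h ⟨N', ⟨e'.trans (e.symm.prodCongr (LinearEquiv.refl A N'))⟩⟩ hpd
  · intro L hL _ _
    rw [pd_eq_zero_of_projective (P := L) inferInstance]
    exact bot_le
  · intro N hN hs hpd
    have h₁ := (hs.trans (isSummand_prod_left X Y)).trans
      (isSummand_prod_left (FGModuleCat.of A (X × Y)) P)
    rcases h₁.of_prod_of_isLocalRing (X := W) (Y := Q) e with h | h
    · exact le_iSup_of_le N (le_iSup_of_le h (le_iSup_of_le hpd le_rfl))
    · have := pd_le_of_isSummand h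
      rw [pd_eq_zero_of_projective hQ] at this
      exact this.trans bot_le
  · intro L N hL hN hs hpd
    have h₁ := isSummand_prod_left L N
    have h₂ := isSummand_prod_right L N
    exact pd_prod_le (hL (h₁.trans hs) (ne_top_of_le_ne_top hpd (pd_le_of_isSummand h₁)))
      (hN (h₂.trans hs) (ne_top_of_le_ne_top hpd (pd_le_of_isSummand h₂)))

/-- If `0 → K' → K → K'' → 0` is exact, `pd K''` is finite and `[K'] = [K]` in `K₀(A)`, then
`pd K''` exceeds by at most `1` the projective dimension of a summand of `K'`, up to projective
summands. -/
theorem pd_le_iSup_add_one {K' K K'' W : FGModuleCat.{u} A} (f : K' →ₗ[A] K) (g : K →ₗ[A] K'')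
    (hf : Function.Injective f) (hfg : Function.Exact f g) (hg : Function.Surjective g)
    (hpd : pd K'' ≠ ⊤) (hK : K₀.mk K' = K₀.mk K) (hW : K₀.mk K' + K₀.mk K = K₀.mk W) :
    pd K'' ≤ (⨆ (N : FGModuleCat.{u} A) (_ : IsSummand N W) (_ : pd N ≠ ⊤), pd N) + 1 := by
  obtain ⟨P, Q, hP, hQ, ⟨e⟩⟩ := stablyIsomorphic_of_mk_eq hK
  -- adding projective summands gives an exact sequence `0 → X → X × P → K'' × Q → 0`
  -- with `X = K' × P`, whose middle term is identified with `(K × Q) × P` by `e`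
  let X : FGModuleCat.{u} A := FGModuleCat.of A (K' × P)
  let D : FGModuleCat.{u} A := FGModuleCat.of A (K'' × Q)
  let E : ((K' × P) × P) ≃ₗ[A] ((K × Q) × P) := e.prodCongr (LinearEquiv.refl A P)
  let α : (K' × P) →ₗ[A] ((K × Q) × P) := (LinearMap.inl A K Q ∘ₗ f).prodMap LinearMap.id
  let β : ((K × Q) × P) →ₗ[A] (K'' × Q) := g.prodMap LinearMap.id ∘ₗ LinearMap.fst A (K × Q) P
  have hα : Function.Injective α := by
    rintro ⟨a, p⟩ ⟨a', p'⟩ h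
    have h1 : f a = f a' := congrArg (fun z => z.1.1) h
    have h2 : p = p' := congrArg (fun z => z.2) h
    rw [hf h1, h2]
  have hβ : Function.Surjective β := by
    rintro ⟨c, q⟩
    obtain ⟨k, rfl⟩ := hg c
    exact ⟨((k, q), 0), rfl⟩
  have hαβ : Function.Exact α β := by
    rintro ⟨⟨k, q⟩, p⟩
    constructor
    · intro h
      have h1 : g k = 0 := congrArg Prod.fst h
      have h2 : q = 0 := congrArg Prod.snd h
      obtain ⟨a, rfl⟩ := (hfg k).mp h1
      exact ⟨(a, p), by rw [h2]; rfl⟩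
    · rintro ⟨⟨a, p'⟩, h⟩
      have h1 : f a = k := congrArg (fun z => z.1.1) h
      have h2 : 0 = q := congrArg (fun z => z.1.2) h
      subst h1 h2
      exact Prod.ext (hfg.apply_apply_eq_zero a) rfl
  have hD : pd D ≠ ⊤ := ne_top_of_le_ne_top hpd
    (pd_prod_le le_rfl ((pd_eq_zero_of_projective hQ).trans_le bot_le))
  obtain ⟨Z, hZ, hZt, hDZ⟩ := exists_isSummand_pd_le_pd_add_one (X := X) (P := P) (D := D) hP
    (E.symm.toLinearMap ∘ₗ α) (β ∘ₗ E.toLinearMap) (E.symm.injective.comp hα)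
    (fun y => by
      change β (E y) = 0 ↔ y ∈ Set.range (E.symm ∘ α)
      rw [hαβ (E y)]
      constructor
      · rintro ⟨x, hx⟩
        exact ⟨x, by simp [hx]⟩
      · rintro ⟨x, rfl⟩
        exact ⟨x, by simp⟩)
    (hβ.comp E.surjective) hD
  have hX : K₀.mk X + K₀.mk K = K₀.mk W := by
    rw [K₀.mk_prod, K₀.mk_projective hP, add_zero, hW]
  calc pd K'' ≤ pd D := pd_le_of_isSummand (isSummand_prod_left K'' Q)
    _ ≤ pd Z + 1 := hDZ
    _ ≤ _ := by
      gcongr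
      exact pd_le_iSup_of_mk_add_eq hZ hX hZt

/-- The Igusa–Todorov inequality over an artinian ring. -/
theorem pd_le_psi_add_one {M' M M'' : FGModuleCat.{u} A} (f : M' →ₗ[A] M) (g : M →ₗ[A] M'')
    (hf : Function.Injective f) (hfg : Function.Exact f g) (hg : Function.Surjective g)
    (hpd : pd M'' ≠ ⊤) : pd M'' ≤ psi (FGModuleCat.of A (M' × M)) + 1 := by
  obtain ⟨n, hn⟩ := ENat.ne_top_iff_exists.mp hpd
  let X : FGModuleCat.{u} A := FGModuleCat.of A (M' × M)
  rcases le_total n (phi X) with hle | hle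
  · rw [← hn, psi]
    calc (n : ℕ∞) ≤ phi X := Nat.cast_le.mpr hle
      _ ≤ _ := le_self_add.trans le_self_add
  obtain ⟨s, rfl⟩ := Nat.exists_eq_add_of_le hle
  have hmem : K₀.mk M' - K₀.mk M ∈ addSubgroup X :=
    sub_mem (mk_mem_addSubgroup (isSummand_prod_left M' M))
      (mk_mem_addSubgroup (isSummand_prod_right M' M))
  -- the syzygy of order `pd M''` of the sequence splits
  have hzero : (syzygyHom (A := A))^[phi X + s] (K₀.mk M' - K₀.mk M) = 0 := by
    obtain ⟨K', K, K'', f₁, g₁, hf₁, hfg₁, hg₁, h', h, hK⟩ :=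
      exists_exact_iterate f g hf hfg hg (phi X + s)
    have h0 : pd K'' ≤ (0 : ℕ) := (hK 0).mp (by rw [zero_add, hn])
    rw [iterate_map_sub, ← h', ← h, mk_eq_of_exact_of_projective f₁ g₁ hf₁ hfg₁ hg₁
      (projective_of_pd_le_zero h0), sub_self]
  have hphi := iterate_phi_eq_zero hmem hzero
  obtain ⟨K', K, K'', f₁, g₁, hf₁, hfg₁, hg₁, h', h, hK⟩ :=
    exists_exact_iterate f g hf hfg hg (phi X)
  have hKt : pd K'' ≠ ⊤ := ne_top_of_le_ne_top (ENat.natCast_ne_top s)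
    ((hK s).mp (by rw [add_comm, hn]))
  have hKK : K₀.mk K' = K₀.mk K := by
    rw [h', h, ← sub_eq_zero, ← iterate_map_sub]
    exact hphi
  have hW : K₀.mk K' + K₀.mk K = K₀.mk (iteratedSyzygy (phi X) X) := by
    rw [mk_iteratedSyzygy, K₀.mk_prod, iterate_map_add, h', h]
  have hle' := pd_le_iSup_add_one f₁ g₁ hf₁ hfg₁ hg₁ hKt hKK hW
  obtain ⟨m, hm⟩ := ENat.ne_top_iff_exists.mp (iSup_pd_summand_ne_top (iteratedSyzygy (phi X) X))
  rw [← hm] at hle'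
  have h1 : pd M'' ≤ (m + 1 + phi X : ℕ) := (hK (m + 1)).mpr hle'
  rw [psi, ← hm]
  refine h1.trans_eq ?_
  push_cast
  rw [add_comm, add_assoc]

theorem psi_ne_top (M : FGModuleCat.{u} A) : psi M ≠ ⊤ :=
  WithTop.add_ne_top.mpr ⟨ENat.natCast_ne_top _, iSup_pd_summand_ne_top _⟩

end Summands

end

end IgusaTodorov

theorem mainTheorem10 (R : Type w) [CommRing R] [IsArtinianRing R]
    (A : Type u) [Ring A] [Algebra R A] [Module.Finite R A]
    (M' M M'' : Type u)
    [AddCommGroup M'] [Module A M'] [Module.Finite A M']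
    [AddCommGroup M] [Module A M] [Module.Finite A M]
    [AddCommGroup M''] [Module A M''] [Module.Finite A M'']
    (f : M' →ₗ[A] M) (g : M →ₗ[A] M'')
    (hf : Function.Injective f) (hfg : Function.Exact f g) (hg : Function.Surjective g)
    (hpd : IgusaTodorov.pd (FGModuleCat.of A M'') ≠ ⊤) :
    haveI : IsArtinianRing A := IsArtinianRing.of_finite R A
    IgusaTodorov.psi (FGModuleCat.of A (M' × M)) ≠ ⊤ ∧
      IgusaTodorov.pd (FGModuleCat.of A M'') ≤
        IgusaTodorov.psi (FGModuleCat.of A (M' × M)) + 1 := by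
  have : IsArtinianRing A := IsArtinianRing.of_finite R A
  exact ⟨IgusaTodorov.psi_ne_top _, IgusaTodorov.pd_le_psi_add_one (M' := FGModuleCat.of A M')
    (M := FGModuleCat.of A M) (M'' := FGModuleCat.of A M'') f g hf hfg hg hpd⟩
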